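/- Let $P, Q \ge 0$. Consider the two-user Gaussian multicast channel with real symbols: in $n$ channel uses receiver $k\in\{1,2\}$ observes $$Y_k^n = X^n + S_k^n + Z_k^n,$$ where the interference sequences $S_1^n, S_2^n$ are i.i.d. $\mathcal N(0,Q)$, the noise sequences $Z_1^n, Z_2^n$ are i.i.d. $\mathcal N(0,1)$, and all of these are mutually independent and independent of the message. A $(2^{nR},n)$ code consists of a message $W$ uniformly distributed over a set of $\lfloor 2^{nR}\rfloor$ messages, an encoder $X^n = f_n(W,S_1^n,S_2^n)$ (so both interference sequences are known noncausally to the transmitter) which satisfies $\frac1n E\big[\sum_{i=1}^n X_i^2\big]\le P$, and two decoders $g_{1,n}, g_{2,n}$, where $g_{k,n}$ observes $Y_k^n$ only. A rate $R\ge 0$ is achievable if there is a sequence of such codes, one for each $n$, with $\Pr\big(\bigcup_{k=1}^2\{g_{k,n}(Y_k^n)\ne W\}\big)\to 0$ as $n\to\infty$, and the capacity $C$ is the supremum of the achievable rates. Then $$C \le \min\{R_+^{\mathrm I}, R_+^{\mathrm{II}}\},$$ where, with $\log=\log_2$ and $[a]^+=\max(a,0)$, $$R_+^{\mathrm I} =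 \begin{cases} \frac14\log(1+P)+\frac14\log\left(\frac{P+Q+1+2\sqrt{PQ}}{Q}\right) & Q\ge 4,\\ \frac14\log\left(\frac{1+P}{Q/4+1}\right)+\frac14\log\left(\frac{P+Q+1+2\sqrt{PQ}}{Q/4+1}\right) & Q<4,\end{cases}$$ $$R_+^{\mathrm{II}} = \begin{cases} \frac12\log\left(\frac{1+P+Q+2\sqrt{PQ}}{1+Q/2}\right) & Q\le 2,\\ \frac12\log\left(\frac{1+P+Q+2\sqrt{PQ}}{\sqrt{2Q}}\right)-\left[\frac14\log\left(\frac{Q}{2P+2}\right)\right]^+ & Q>2.\end{cases}$$ -/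

import Mathlib

open MeasureTheory ProbabilityTheory Filter Topology

noncomputable section

namespace GaussianMulticast

/-- A (deterministic) code of block length `n` with `M` messages for the two-user multicast
channel: the encoder sees the message and both whole interference sequences (noncausally), and
decoder `k` sees only the sequence received at receiver `k`. -/
structure Code (n M : ℕ) where
  /-- The encoder `X^n(w, s_1^n, s_2^n)`. -/
  encode : Fin M → (Fin 2 → Fin n → ℝ) → Fin n → ℝ
  measurable_encode : ∀ w, Measurable (encode w)
  /-- The decoders. -/
  decode : Fin 2 → (Fin n → ℝ) → Fin M
  measurable_decode : ∀ k, Measurable (decode k)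

/-- Sample space of `n` uses of the channel: the message, the interferences `S_k^n` and the
noises `Z_k^n`, for the receivers `k`. -/
abbrev Sample (n M : ℕ) : Type :=
  Fin M × (Fin 2 → Fin n → ℝ) × (Fin 2 → Fin n → ℝ)

/-- Two independent sequences of i.i.d. `N(0, v)` random variables of length `n`. -/
def whiteGaussian (n : ℕ) (v : ℝ) : Measure (Fin 2 → Fin n → ℝ) :=
  Measure.pi fun _ => Measure.pi fun _ => gaussianReal 0 v.toNNReal

/-- Joint law: the message is uniform, the interferences are i.i.d. `N(0, Q)`, the noises are
i.i.d. `N(0, 1)`, and all of these are mutually independent. -/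
def law (n M : ℕ) (Q : ℝ) : Measure (Sample n M) :=
  (uniformOn (Set.univ : Set (Fin M))).prod ((whiteGaussian n Q).prod (whiteGaussian n 1))

namespace Code

variable {n M : ℕ}

/-- The transmitted sequence `X^n`. -/
def input (c : Code n M) (ω : Sample n M) : Fin n → ℝ :=
  c.encode ω.1 ω.2.1

/-- The sequence received at receiver `k`: `Y_k^n = X^n + S_k^n + Z_k^n`. -/
def output (c : Code n M) (k : Fin 2) (ω : Sample n M) : Fin n → ℝ :=
  fun i => c.input ω i + ω.2.1 k i + ω.2.2 k i

/-- Average power constraint; the expectation is over messages and interferences and is required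
to exist. -/
def SatisfiesPower (c : Code n M) (P Q : ℝ) : Prop :=
  Integrable (fun ω => ∑ i, c.input ω i ^ 2) (law n M Q) ∧
    (1 / (n : ℝ)) * ∫ ω, ∑ i, c.input ω i ^ 2 ∂(law n M Q) ≤ P

/-- Probability that at least one of the two receivers decodes incorrectly. -/
def errorProb (c : Code n M) (Q : ℝ) : ENNReal :=
  law n M Q {ω | ∃ k, c.decode k (c.output k ω) ≠ ω.1}

end Code

/-- `R` is achievable: there are codes of every block length `n` with `⌊2 ^ (n R)⌋` messages that
satisfy the power constraint and whose error probability tends to zero. -/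
def Achievable (P Q R : ℝ) : Prop :=
  0 ≤ R ∧ ∃ c : (n : ℕ) → Code n ⌊(2 : ℝ) ^ ((n : ℝ) * R)⌋₊,
    (∀ n, (c n).SatisfiesPower P Q) ∧
      Tendsto (fun n => (c n).errorProb Q) atTop (𝓝 0)

/-- The capacity: supremum of the achievable rates, taken in the extended reals so that it is
a genuine supremum without boundedness assumptions. -/
def capacity (P Q : ℝ) : EReal :=
  ⨆ R ∈ {R : ℝ | Achievable P Q R}, (R : EReal)

/-- The bound `R_+^I`. -/
def boundI (P Q : ℝ) : ℝ :=
  if 4 ≤ Q then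
    1 / 4 * Real.logb 2 (1 + P) + 1 / 4 * Real.logb 2 ((P + Q + 1 + 2 * √(P * Q)) / Q)
  else
    1 / 4 * Real.logb 2 ((1 + P) / (Q / 4 + 1)) +
      1 / 4 * Real.logb 2 ((P + Q + 1 + 2 * √(P * Q)) / (Q / 4 + 1))

/-- The bound `R_+^II`. -/
def boundII (P Q : ℝ) : ℝ :=
  if Q ≤ 2 then
    1 / 2 * Real.logb 2 ((1 + P + Q + 2 * √(P * Q)) / (1 + Q / 2))
  else
    1 / 2 * Real.logb 2 ((1 + P + Q + 2 * √(P * Q)) / √(2 * Q)) -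
      max (1 / 4 * Real.logb 2 (Q / (2 * P + 2))) 0

end GaussianMulticast

end

noncomputable section

open MeasureTheory ProbabilityTheory Filter Topology

namespace GaussianMulticast

/-! Each decoder sees only its own output, so its error probability depends on the noises only
through their marginals. The two noises may therefore be coupled as `N + D` and `N - D`, with
independent Gaussian `N`, `D` of variances `(1 + r) / 2` and `(1 - r) / 2`: each has variance 1, and
their correlation `r` in `[0, 1]` is free.

Under this coupling `Y₁ = U + Y₂` and `Y₂ = B + N`, where `U` is Gaussian and independent of the
message, and `N` is independent of `(B, U)`. In entropy terms the two informations about the message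
sum to at most `h(Y₁) + h(Y₂) - h(U) - h(N)`, and second moments bound the first two terms.
`log_mul_prob_le` proves this without entropy or Fano's inequality: Gaussian reference densities,
tilted by the factor `M` towards correct decoding, enter a likelihood ratio of expectation at most
1, and `exp x ≥ 1 + x` bounds the expected logarithm.

`Code.log_card_le` uses `U = S₁ - S₂ + 2 D`. `Code.log_card_le_side` gives `S₂` to the second
receiver, so that `Y₂` becomes `X + Z₂` and `U = S₁ + 2 D`. After `le_of_log_card_le` lets `n` grow,
the best `r` gives `boundI` and the uncorrected `boundII`. The correction in `boundII` needs no
separate converse, as it follows from `boundI` (`boundI_le_of_two_lt`). -/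

/-! ### Gaussian vectors: density, linear combinations, second moments. -/

/-- The law of `n` i.i.d. `N(0, v)` random variables. -/
def gaussianVec (n : ℕ) (v : ℝ) : Measure (Fin n → ℝ) :=
  Measure.pi fun _ => gaussianReal 0 v.toNNReal

instance (n : ℕ) (v : ℝ) : IsProbabilityMeasure (gaussianVec n v) := by
  unfold gaussianVec; infer_instance

instance (n : ℕ) (v : ℝ) : IsProbabilityMeasure (whiteGaussian n v) := by
  unfold whiteGaussian; infer_instance

/-- The Lebesgue density of `gaussianVec n v`. -/
def gaussianVecPDF (n : ℕ) (v : ℝ) (x : Fin n → ℝ) : ℝ :=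
  Real.exp (-(n / 2 * Real.log (2 * Real.pi * v)) - (∑ i, x i ^ 2) / (2 * v))

lemma gaussianVecPDF_pos (n : ℕ) (v : ℝ) (x : Fin n → ℝ) : 0 < gaussianVecPDF n v x :=
  Real.exp_pos _

@[fun_prop]
lemma measurable_gaussianVecPDF (n : ℕ) (v : ℝ) : Measurable (gaussianVecPDF n v) := by
  unfold gaussianVecPDF; fun_prop

lemma prod_gaussianPDFReal {n : ℕ} {v : ℝ} (hv : 0 < v) (x : Fin n → ℝ) :
    ∏ i, gaussianPDFReal 0 v.toNNReal (x i) = gaussianVecPDF n v x := by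
  have h2 : (√(2 * Real.pi * v))⁻¹ = Real.exp (-(1 / 2 * Real.log (2 * Real.pi * v))) := by
    rw [Real.exp_neg, Real.sqrt_eq_rpow, Real.rpow_def_of_pos (by positivity)]
    ring_nf
  simp only [gaussianPDFReal, gaussianVecPDF, Real.coe_toNNReal v hv.le, h2, ← Real.exp_add]
  rw [← Real.exp_sum]
  congr 1
  simp only [sub_zero, Finset.sum_add_distrib, Finset.sum_const, Finset.card_univ,
    Fintype.card_fin, nsmul_eq_mul, neg_div, Finset.sum_neg_distrib, ← Finset.sum_div]
  ring

lemma gaussianVec_eq_withDensity {n : ℕ} {v : ℝ} (hv : 0 < v) :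
    gaussianVec n v = volume.withDensity fun x => ENNReal.ofReal (gaussianVecPDF n v x) := by
  have hv' : v.toNNReal ≠ 0 := by simpa using hv
  refine Measure.pi_eq fun s hs => ?_
  have hint : ∀ i, Integrable ((s i).indicator (gaussianPDFReal 0 v.toNNReal)) :=
    fun i => (integrable_gaussianPDFReal _ _).indicator (hs i)
  have hnn : ∀ i x, 0 ≤ (s i).indicator (gaussianPDFReal 0 v.toNNReal) x := fun i x =>
    Set.indicator_nonneg (fun _ _ => gaussianPDFReal_nonneg _ _ _) _
  have key : ∀ x : Fin n → ℝ, (Set.univ.pi s).indicator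
      (fun x => ENNReal.ofReal (gaussianVecPDF n v x)) x =
      ENNReal.ofReal (∏ i, (s i).indicator (gaussianPDFReal 0 v.toNNReal) (x i)) := by
    intro x
    by_cases hx : x ∈ Set.univ.pi s
    · rw [Set.indicator_of_mem hx, ← prod_gaussianPDFReal hv]
      congr 1
      exact Finset.prod_congr rfl fun i _ => by rw [Set.indicator_of_mem (hx i trivial)]
    · rw [Set.indicator_of_notMem hx]
      simp only [Set.mem_pi, Set.mem_univ, true_imp_iff, not_forall] at hx
      obtain ⟨i, hi⟩ := hx
      rw [Finset.prod_eq_zero (Finset.mem_univ i) (Set.indicator_of_notMem hi _)]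
      simp
  rw [withDensity_apply _ (.univ_pi hs), ← lintegral_indicator (.univ_pi hs)]
  simp_rw [key]
  rw [← ofReal_integral_eq_lintegral_ofReal, integral_fintype_prod_volume_eq_prod,
    ENNReal.ofReal_prod_of_nonneg fun i _ => integral_nonneg (hnn i)]
  · refine Finset.prod_congr rfl fun i _ => ?_
    rw [integral_indicator (hs i), gaussianReal_apply_eq_integral _ hv']
  · exact Integrable.fintype_prod hint
  · exact ae_of_all _ fun x => Finset.prod_nonneg fun i _ => hnn i _

lemma lintegral_gaussianVec {n : ℕ} {v : ℝ} (hv : 0 < v) {f : (Fin n → ℝ) → ENNReal}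
    (hf : Measurable f) :
    ∫⁻ x, f x ∂gaussianVec n v = ∫⁻ x, ENNReal.ofReal (gaussianVecPDF n v x) * f x := by
  rw [gaussianVec_eq_withDensity hv, lintegral_withDensity_eq_lintegral_mul _ (by fun_prop) hf]
  rfl

lemma gaussianReal_prod_map_linearComb {v₁ v₂ v a b : ℝ} (h₁ : 0 ≤ v₁) (h₂ : 0 ≤ v₂)
    (h : v = a ^ 2 * v₁ + b ^ 2 * v₂) :
    ((gaussianReal 0 v₁.toNNReal).prod (gaussianReal 0 v₂.toNNReal)).map
      (fun p => a * p.1 + b * p.2) = gaussianReal 0 v.toNNReal := by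
  have e : (fun p : ℝ × ℝ => a * p.1 + b * p.2) =
      (fun p => p.1 + p.2) ∘ Prod.map (a * ·) (b * ·) := rfl
  rw [e, ← Measure.map_map (by fun_prop) (by fun_prop),
    ← Measure.map_prod_map _ _ (by fun_prop) (by fun_prop), gaussianReal_map_const_mul,
    gaussianReal_map_const_mul]
  change Measure.conv _ _ = _
  rw [gaussianReal_conv_gaussianReal]
  congr 1
  · simp
  · ext
    subst h
    rw [Real.coe_toNNReal _ (by positivity)]
    simp [h₁, h₂]

lemma measurePreserving_linearComb {n : ℕ} {v₁ v₂ v a b : ℝ} (h₁ : 0 ≤ v₁) (h₂ : 0 ≤ v₂)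
    (h : v = a ^ 2 * v₁ + b ^ 2 * v₂) :
    MeasurePreserving (fun (p : (Fin n → ℝ) × (Fin n → ℝ)) i => a * p.1 i + b * p.2 i)
      ((gaussianVec n v₁).prod (gaussianVec n v₂)) (gaussianVec n v) := by
  refine ⟨by fun_prop, ?_⟩
  have hm := measurePreserving_arrowProdEquivProdArrow ℝ ℝ (Fin n)
    (fun _ => gaussianReal 0 v₁.toNNReal) (fun _ => gaussianReal 0 v₂.toNNReal)
  unfold gaussianVec
  rw [← hm.map_eq, Measure.map_map (by fun_prop) hm.measurable]
  have : ∀ i : Fin n, SigmaFinite (((gaussianReal 0 v₁.toNNReal).prod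
      (gaussianReal 0 v₂.toNNReal)).map (fun p => a * p.1 + b * p.2)) := fun _ => by
    rw [gaussianReal_prod_map_linearComb h₁ h₂ h]; infer_instance
  have := Measure.pi_map_pi (hμ := this) (μ := fun _ : Fin n => (gaussianReal 0 v₁.toNNReal).prod
      (gaussianReal 0 v₂.toNNReal)) (f := fun _ p => a * p.1 + b * p.2)
      (fun _ => by fun_prop)
  rw [gaussianReal_prod_map_linearComb h₁ h₂ h] at this
  exact this

lemma memLp_eval_gaussianVec {n : ℕ} (v : ℝ) (i : Fin n) :
    MemLp (fun x : Fin n → ℝ => x i) 2 (gaussianVec n v) :=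
  (memLp_id_gaussianReal' 2 (by simp)).comp_measurePreserving
    (measurePreserving_eval (fun _ : Fin n => gaussianReal 0 v.toNNReal) i)

lemma integral_eval_gaussianVec {n : ℕ} (v : ℝ) (i : Fin n) :
    ∫ x, x i ∂gaussianVec n v = 0 := by
  have h := measurePreserving_eval (fun _ : Fin n => gaussianReal 0 v.toNNReal) i
  have := integral_map (μ := gaussianVec n v) h.measurable.aemeasurable
    (f := fun x : ℝ => x) (by fun_prop)
  unfold gaussianVec at this ⊢
  rw [h.map_eq, integral_id_gaussianReal] at this
  exact this.symm

lemma integral_eval_sq_gaussianVec {n : ℕ} {v : ℝ} (hv : 0 ≤ v) (i : Fin n) :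
    ∫ x, x i ^ 2 ∂gaussianVec n v = v := by
  have h := measurePreserving_eval (fun _ : Fin n => gaussianReal 0 v.toNNReal) i
  have h1 := integral_map (μ := gaussianVec n v) h.measurable.aemeasurable
    (f := fun x : ℝ => x ^ 2) (by fun_prop)
  unfold gaussianVec at h1 ⊢
  rw [h.map_eq] at h1
  have h2 := variance_fun_id_gaussianReal (μ := 0) (v := v.toNNReal)
  rw [variance_of_integral_eq_zero (by fun_prop) integral_id_gaussianReal,
    Real.coe_toNNReal v hv] at h2
  exact h1.symm.trans h2

lemma integrable_sum_sq_gaussianVec (n : ℕ) (v : ℝ) :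
    Integrable (fun x => ∑ i, x i ^ 2) (gaussianVec n v) :=
  integrable_finsetSum _ fun i _ => (memLp_eval_gaussianVec v i).integrable_sq

lemma integral_sum_sq_gaussianVec (n : ℕ) {v : ℝ} (hv : 0 ≤ v) :
    ∫ x, ∑ i, x i ^ 2 ∂gaussianVec n v = n * v := by
  rw [integral_finsetSum _ fun i _ => (memLp_eval_gaussianVec v i).integrable_sq]
  simp [integral_eval_sq_gaussianVec hv]

/-! ### The tilted-density converse for `Y₁ = U + Y₂`, `Y₂ = B + N`. -/

section Converse

variable {n : ℕ} {α τ : Type*}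

/-- The normalisation of the Gaussian law `N(0, s)` tilted by the factor `m` on the section of `E`
at `a`. -/
def tiltMass (n : ℕ) (s m : ℝ) (E : Set (α × (Fin n → ℝ))) (a : α) : ℝ :=
  1 + (m - 1) * (gaussianVec n s).real {y | (a, y) ∈ E}

/-- The logarithm of the density of `N(0, s)` tilted by the factor `m` on the section of `E`. -/
def tiltLog (n : ℕ) (s m : ℝ) (E : Set (α × (Fin n → ℝ))) (p : α × (Fin n → ℝ)) : ℝ :=
  E.indicator (fun _ => Real.log m) p - Real.log (tiltMass n s m E p.1) -
    n / 2 * Real.log (2 * Real.pi * s) - (∑ i, p.2 i ^ 2) / (2 * s)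

variable {s m : ℝ} {E : Set (α × (Fin n → ℝ))}

lemma one_le_tiltMass (hm : 1 ≤ m) (a : α) : 1 ≤ tiltMass n s m E a :=
  le_add_of_nonneg_right (mul_nonneg (by linarith) measureReal_nonneg)

lemma tiltMass_le (hm : 1 ≤ m) (a : α) : tiltMass n s m E a ≤ m := by
  have : (gaussianVec n s).real {y | (a, y) ∈ E} ≤ 1 := measureReal_le_one
  unfold tiltMass
  nlinarith

variable [MeasurableSpace α] [MeasurableSpace τ]

/-- Dividing by the densities of `U` and `N` turns their laws into Lebesgue measure. For fixed `a`,
the map from `(U, N)` to `(Y₁, Y₂)` is then a succession of translations, so the integral is that of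
`r₁ ⊗ r₂`. No regularity of `B` beyond measurability is needed. -/
lemma lintegral_likelihoodRatio_le_one {μ : Measure α} [IsProbabilityMeasure μ] {ν : Measure τ}
    [IsProbabilityMeasure ν] {v u : ℝ} (hv : 0 < v) (hu : 0 < u) {U : τ → Fin n → ℝ}
    (hU : MeasurePreserving U ν (gaussianVec n u)) {B : α × τ → Fin n → ℝ} (hB : Measurable B)
    {r₁ r₂ : α × (Fin n → ℝ) → ENNReal} (hm₁ : Measurable r₁) (hm₂ : Measurable r₂)
    (h₁ : ∀ a, ∫⁻ y, r₁ (a, y) ≤ 1) (h₂ : ∀ a, ∫⁻ y, r₂ (a, y) ≤ 1) :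
    ∫⁻ ω, r₁ (ω.1, U ω.2.1 + (B (ω.1, ω.2.1) + ω.2.2)) * r₂ (ω.1, B (ω.1, ω.2.1) + ω.2.2) *
      (ENNReal.ofReal (gaussianVecPDF n u (U ω.2.1)))⁻¹ *
      (ENNReal.ofReal (gaussianVecPDF n v ω.2.2))⁻¹ ∂(μ.prod (ν.prod (gaussianVec n v))) ≤ 1 := by
  have hUm := hU.measurable
  have hinv : ∀ (w : ℝ) (x : Fin n → ℝ), ENNReal.ofReal (gaussianVecPDF n w x) *
      (ENNReal.ofReal (gaussianVecPDF n w x))⁻¹ = 1 := fun w x =>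
    ENNReal.mul_inv_cancel (by simpa using gaussianVecPDF_pos n w x) ENNReal.ofReal_ne_top
  rw [lintegral_prod _ (by fun_prop)]
  suffices h : ∀ a, ∫⁻ p, r₁ (a, U p.1 + (B (a, p.1) + p.2)) * r₂ (a, B (a, p.1) + p.2) *
      (ENNReal.ofReal (gaussianVecPDF n u (U p.1)))⁻¹ *
      (ENNReal.ofReal (gaussianVecPDF n v p.2))⁻¹ ∂(ν.prod (gaussianVec n v)) ≤ 1 by
    calc _ ≤ ∫⁻ _, 1 ∂μ := lintegral_mono h
      _ = 1 := by simp
  intro a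
  rw [lintegral_prod _ (by fun_prop)]
  set H : (Fin n → ℝ) → ENNReal := fun w => ∫⁻ y, r₁ (a, w + y) * r₂ (a, y) *
    (ENNReal.ofReal (gaussianVecPDF n u w))⁻¹ with hH
  have hHm : Measurable H := by
    have : Measurable fun p : (Fin n → ℝ) × (Fin n → ℝ) =>
        r₁ (a, p.1 + p.2) * r₂ (a, p.2) * (ENNReal.ofReal (gaussianVecPDF n u p.1))⁻¹ := by fun_prop
    exact this.lintegral_prod_right'
  have inner : ∀ t, ∫⁻ z, r₁ (a, U t + (B (a, t) + z)) * r₂ (a, B (a, t) + z) *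
      (ENNReal.ofReal (gaussianVecPDF n u (U t)))⁻¹ *
      (ENNReal.ofReal (gaussianVecPDF n v z))⁻¹ ∂(gaussianVec n v) = H (U t) := by
    intro t
    rw [lintegral_gaussianVec hv (by fun_prop), hH]
    simp only
    -- With `t` fixed, `B (a, t)` is a constant shift, which Lebesgue measure ignores.
    refine Eq.trans (lintegral_congr fun z => ?_) (lintegral_add_left_eq_self (fun y =>
      r₁ (a, U t + y) * r₂ (a, y) * (ENNReal.ofReal (gaussianVecPDF n u (U t)))⁻¹) (B (a, t)))
    rw [mul_left_comm, hinv, mul_one]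
  simp_rw [inner]
  rw [hU.lintegral_comp hHm, lintegral_gaussianVec hu hHm]
  calc ∫⁻ w, ENNReal.ofReal (gaussianVecPDF n u w) * H w
      = ∫⁻ w, ∫⁻ y, r₁ (a, w + y) * r₂ (a, y) := by
        refine lintegral_congr fun w => ?_
        rw [hH, ← lintegral_const_mul _ (by fun_prop)]
        refine lintegral_congr fun y => ?_
        rw [mul_left_comm, hinv, mul_one]
    _ = ∫⁻ y, ∫⁻ w, r₁ (a, w + y) * r₂ (a, y) := lintegral_lintegral_swap (by fun_prop)
    _ = ∫⁻ y, (∫⁻ w, r₁ (a, w)) * r₂ (a, y) := by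
        refine lintegral_congr fun y => ?_
        rw [lintegral_mul_const _ (by fun_prop),
          lintegral_add_right_eq_self (fun w => r₁ (a, w)) y]
    _ ≤ ∫⁻ y, r₂ (a, y) := lintegral_mono fun y => mul_le_of_le_one_left' (h₁ a)
    _ ≤ 1 := h₂ a

/-- Integrate `L + 1 ≤ exp L`; this plays the role of Jensen's inequality. -/
lemma integral_nonpos_of_lintegral_exp_le_one {μ : Measure α} [IsProbabilityMeasure μ] {L : α → ℝ}
    (hL : Integrable L μ) (h : ∫⁻ x, ENNReal.ofReal (Real.exp (L x)) ∂μ ≤ 1) :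
    ∫ x, L x ∂μ ≤ 0 := by
  have hm : AEStronglyMeasurable (fun x => Real.exp (L x)) μ :=
    Real.continuous_exp.comp_aestronglyMeasurable hL.1
  have hi : Integrable (fun x => Real.exp (L x)) μ :=
    ⟨hm, by
      rw [hasFiniteIntegral_iff_ofReal (ae_of_all _ fun x => (Real.exp_pos _).le)]
      exact h.trans_lt ENNReal.one_lt_top⟩
  have h1 : ∫ x, Real.exp (L x) ∂μ ≤ 1 := by
    rw [integral_eq_lintegral_of_nonneg_ae (ae_of_all _ fun x => (Real.exp_pos _).le) hm]
    exact ENNReal.toReal_le_of_le_ofReal zero_le_one (by simpa using h)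
  have h2 : ∫ x, L x ∂μ ≤ ∫ x, (Real.exp (L x) - 1) ∂μ :=
    integral_mono hL (hi.sub (integrable_const _)) fun x => by
      have := Real.add_one_le_exp (L x)
      change L x ≤ Real.exp (L x) - 1
      linarith
  rw [integral_sub hi (integrable_const _)] at h2
  simp only [integral_const, probReal_univ, smul_eq_mul, mul_one] at h2
  linarith

lemma measurable_section_real (hE : MeasurableSet E) :
    Measurable fun a => (gaussianVec n s).real {y | (a, y) ∈ E} :=
  (measurable_measure_prodMk_left hE).ennreal_toReal

lemma measurable_tiltMass (hE : MeasurableSet E) : Measurable (tiltMass n s m E) := by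
  have := measurable_section_real (s := s) hE
  unfold tiltMass
  fun_prop

lemma measurable_tiltLog (hE : MeasurableSet E) : Measurable (tiltLog n s m E) := by
  have h1 := measurable_tiltMass (s := s) (m := m) hE
  have h2 : Measurable (E.indicator fun _ => Real.log m) := measurable_const.indicator hE
  unfold tiltLog
  fun_prop

/-- `tiltMass` is exactly the total mass of the Gaussian density multiplied by `m` on the section of
`E`. -/
lemma lintegral_exp_tiltLog (hs : 0 < s) (hm : 1 ≤ m) (hE : MeasurableSet E) (a : α) :
    ∫⁻ y, ENNReal.ofReal (Real.exp (tiltLog n s m E (a, y))) ≤ 1 := by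
  have hc : 0 < tiltMass n s m E a := zero_lt_one.trans_le (one_le_tiltMass hm a)
  set D : Set (Fin n → ℝ) := {y | (a, y) ∈ E} with hD
  have hDm : MeasurableSet D := measurable_prodMk_left hE
  have hpt : ∀ y, ENNReal.ofReal (Real.exp (tiltLog n s m E (a, y))) =
      ENNReal.ofReal (tiltMass n s m E a)⁻¹ * (ENNReal.ofReal (gaussianVecPDF n s y) *
        (1 + D.indicator (fun _ => ENNReal.ofReal (m - 1)) y)) := by
    intro y
    have : Real.exp (tiltLog n s m E (a, y)) = (tiltMass n s m E a)⁻¹ *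
        (gaussianVecPDF n s y * (1 + D.indicator (fun _ => m - 1) y)) := by
      have e1 : 1 + D.indicator (fun _ => m - 1) y =
          Real.exp (E.indicator (fun _ => Real.log m) (a, y)) := by
        by_cases hy : (a, y) ∈ E
        · rw [Set.indicator_of_mem hy, Set.indicator_of_mem (s := D) hy,
            Real.exp_log (by linarith)]
          ring
        · rw [Set.indicator_of_notMem hy, Set.indicator_of_notMem (s := D) hy]
          simp
      rw [e1, gaussianVecPDF, ← Real.exp_log (inv_pos.2 hc), ← Real.exp_add, ← Real.exp_add,
        Real.log_inv, tiltLog]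
      congr 1
      ring
    have hnn : 0 ≤ D.indicator (fun _ => m - 1) y :=
      Set.indicator_nonneg (fun _ _ => by linarith) _
    rw [this, ENNReal.ofReal_mul (inv_pos.2 hc).le,
      ENNReal.ofReal_mul (gaussianVecPDF_pos _ _ _).le, ENNReal.ofReal_add zero_le_one hnn,
      ENNReal.ofReal_one]
    congr 3
    by_cases hy : y ∈ D <;> simp [hy]
  simp_rw [hpt]
  have hind : Measurable (D.indicator fun _ => ENNReal.ofReal (m - 1)) :=
    measurable_const.indicator hDm
  rw [lintegral_const_mul _ (by fun_prop), ← lintegral_gaussianVec hs (by fun_prop),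
    lintegral_add_left measurable_const, lintegral_indicator hDm, lintegral_const,
    setLIntegral_const, measure_univ, one_mul, ← ENNReal.ofReal_one,
    ← ofReal_measureReal, ← ENNReal.ofReal_mul (by linarith),
    ← ENNReal.ofReal_add zero_le_one (mul_nonneg (by linarith) measureReal_nonneg),
    ← ENNReal.ofReal_mul (inv_pos.2 hc).le]
  refine ENNReal.ofReal_le_ofReal (le_of_eq ?_)
  exact inv_mul_cancel₀ hc.ne'

lemma integrable_log_tiltMass {μ : Measure α} [IsProbabilityMeasure μ] (hm : 1 ≤ m)
    (hE : MeasurableSet E) : Integrable (fun a => Real.log (tiltMass n s m E a)) μ := by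
  refine Integrable.of_bound
    (Real.measurable_log.comp (measurable_tiltMass hE)).aestronglyMeasurable (Real.log m)
    (ae_of_all _ fun a => ?_)
  have h := one_le_tiltMass (n := n) (s := s) (E := E) hm a
  rw [Real.norm_of_nonneg (Real.log_nonneg h)]
  exact Real.log_le_log (by linarith) (tiltMass_le hm a)

/-- Substitute for Fano's inequality: if `E` has average probability at most `1 / m` under the
reference law, rewarding it by `log m` costs at most 1 in normalisation, since `log (1 + x) ≤ x`. -/
lemma integral_log_tiltMass_le {μ : Measure α} [IsProbabilityMeasure μ] (hm : 1 ≤ m)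
    (hE : MeasurableSet E)
    (h : ∫ a, (gaussianVec n s).real {y | (a, y) ∈ E} ∂μ ≤ 1 / m) :
    ∫ a, Real.log (tiltMass n s m E a) ∂μ ≤ 1 := by
  have hi : Integrable (fun a => (gaussianVec n s).real {y | (a, y) ∈ E}) μ :=
    Integrable.of_bound (measurable_section_real hE).aestronglyMeasurable 1
      (ae_of_all _ fun a => by
        rw [Real.norm_of_nonneg measureReal_nonneg]; exact measureReal_le_one)
  calc ∫ a, Real.log (tiltMass n s m E a) ∂μ
      ≤ ∫ a, (m - 1) * (gaussianVec n s).real {y | (a, y) ∈ E} ∂μ := by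
        refine integral_mono (integrable_log_tiltMass hm hE) (hi.const_mul _) fun a => ?_
        have h := one_le_tiltMass (n := n) (s := s) (E := E) hm a
        have := Real.log_le_sub_one_of_pos (x := tiltMass n s m E a) (by linarith)
        unfold tiltMass at this ⊢
        simp only
        linarith
    _ ≤ (m - 1) * (1 / m) := by
        rw [integral_const_mul]
        exact mul_le_mul_of_nonneg_left h (by linarith)
    _ ≤ 1 := by
        have : 0 < m := by linarith
        rw [mul_one_div, div_le_one this]
        linarith

/-- The converse for the pair of outputs `Y₁ = U + B + N`, `Y₂ = B + N`, where `N` is independent of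
everything else and `U` is Gaussian and independent of the side information `a`. -/
lemma log_mul_prob_le {μ : Measure α} [IsProbabilityMeasure μ] {ν : Measure τ}
    [IsProbabilityMeasure ν] {v u : ℝ} (hv : 0 < v) (hu : 0 < u) {U : τ → Fin n → ℝ}
    (hU : MeasurePreserving U ν (gaussianVec n u)) {B : α × τ → Fin n → ℝ} (hB : Measurable B)
    {s₁ s₂ : ℝ} (hs₁ : 0 < s₁) (hs₂ : 0 < s₂) (hm : 1 ≤ m) {E₁ E₂ : Set (α × (Fin n → ℝ))}
    (hE₁ : MeasurableSet E₁) (hE₂ : MeasurableSet E₂)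
    (h₁ : ∫ a, (gaussianVec n s₁).real {y | (a, y) ∈ E₁} ∂μ ≤ 1 / m)
    (h₂ : ∫ a, (gaussianVec n s₂).real {y | (a, y) ∈ E₂} ∂μ ≤ 1 / m)
    {Y₁ Y₂ : α × τ × (Fin n → ℝ) → Fin n → ℝ}
    (hY₁ : ∀ ω, Y₁ ω = U ω.2.1 + Y₂ ω)
    (hY₂ : ∀ ω, Y₂ ω = B (ω.1, ω.2.1) + ω.2.2)
    (hi₁ : Integrable (fun ω => ∑ i, Y₁ ω i ^ 2) (μ.prod (ν.prod (gaussianVec n v))))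
    (hi₂ : Integrable (fun ω => ∑ i, Y₂ ω i ^ 2) (μ.prod (ν.prod (gaussianVec n v))))
    (hp₁ : ∫ ω, ∑ i, Y₁ ω i ^ 2 ∂(μ.prod (ν.prod (gaussianVec n v))) ≤ n * s₁)
    (hp₂ : ∫ ω, ∑ i, Y₂ ω i ^ 2 ∂(μ.prod (ν.prod (gaussianVec n v))) ≤ n * s₂) :
    Real.log m * ((μ.prod (ν.prod (gaussianVec n v))).real {ω | (ω.1, Y₁ ω) ∈ E₁} +
      (μ.prod (ν.prod (gaussianVec n v))).real {ω | (ω.1, Y₂ ω) ∈ E₂}) ≤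
      2 + n / 2 * (Real.log s₁ + Real.log s₂ - Real.log v - Real.log u) := by
  set ρ := μ.prod (ν.prod (gaussianVec n v)) with hρ
  have hUm := hU.measurable
  have hY₂m : Measurable Y₂ := by rw [funext hY₂]; fun_prop
  have hY₁m : Measurable Y₁ := by rw [funext hY₁]; fun_prop
  have hfst : MeasurePreserving Prod.fst ρ μ := measurePreserving_fst
  have hmU : MeasurePreserving (fun ω : α × τ × (Fin n → ℝ) => U ω.2.1) ρ (gaussianVec n u) :=
    hU.comp (measurePreserving_fst.comp measurePreserving_snd)
  have hmN : MeasurePreserving (fun ω : α × τ × (Fin n → ℝ) => ω.2.2) ρ (gaussianVec n v) :=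
    measurePreserving_snd.comp measurePreserving_snd
  -- Lower bound for the expected log of a tilted density: the gain is `log m` times the probability
  -- of `E`, the normalisation costs at most 1, and the power bound makes the quadratic term at most
  -- `n / 2`.
  have key : ∀ {t : ℝ}, 0 < t → ∀ {E : Set (α × (Fin n → ℝ))}, MeasurableSet E →
      ∫ a, (gaussianVec n t).real {y | (a, y) ∈ E} ∂μ ≤ 1 / m →
      ∀ {Y : α × τ × (Fin n → ℝ) → Fin n → ℝ}, Measurable Y →
      Integrable (fun ω => ∑ i, Y ω i ^ 2) ρ → ∫ ω, ∑ i, Y ω i ^ 2 ∂ρ ≤ n * t →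
      Integrable (fun ω => tiltLog n t m E (ω.1, Y ω)) ρ ∧
      Real.log m * ρ.real {ω | (ω.1, Y ω) ∈ E} - 1 - n / 2 * Real.log (2 * Real.pi * t) - n / 2 ≤
        ∫ ω, tiltLog n t m E (ω.1, Y ω) ∂ρ := by
    intro t ht E hE hEm Y hYm hYi hYp
    have hS : MeasurableSet {ω | (ω.1, Y ω) ∈ E} := by
      have : Measurable fun ω : α × τ × (Fin n → ℝ) => (ω.1, Y ω) := by fun_prop
      exact this hE
    have e : (fun ω => tiltLog n t m E (ω.1, Y ω)) = fun ω : α × τ × (Fin n → ℝ) =>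
        {ω | (ω.1, Y ω) ∈ E}.indicator (fun _ => Real.log m) ω -
          Real.log (tiltMass n t m E ω.1) -
          n / 2 * Real.log (2 * Real.pi * t) - (∑ i, Y ω i ^ 2) / (2 * t) := by
      funext ω
      rfl
    have i1 : Integrable ({ω : α × τ × (Fin n → ℝ) | (ω.1, Y ω) ∈ E}.indicator
        (fun _ => Real.log m)) ρ := (integrable_const _).indicator hS
    have i2 : Integrable (fun ω : α × τ × (Fin n → ℝ) => Real.log (tiltMass n t m E ω.1)) ρ :=
      hfst.integrable_comp_of_integrable (integrable_log_tiltMass hm hE)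
    have v2 : ∫ ω, Real.log (tiltMass n t m E ω.1) ∂ρ = ∫ a, Real.log (tiltMass n t m E a) ∂μ := by
      rw [← hfst.map_eq, integral_map hfst.measurable.aemeasurable]
      exact (Real.measurable_log.comp (measurable_tiltMass hE)).aestronglyMeasurable
    have h2 := integral_log_tiltMass_le hm hE hEm
    have i4 := hYi.div_const (2 * t)
    rw [e]
    have ic : Integrable (fun _ : α × τ × (Fin n → ℝ) => n / 2 * Real.log (2 * Real.pi * t)) ρ :=
      integrable_const _
    refine ⟨((i1.sub i2).sub ic).sub i4, ?_⟩
    rw [integral_sub (f := fun ω : α × τ × (Fin n → ℝ) =>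
        {ω | (ω.1, Y ω) ∈ E}.indicator (fun _ => Real.log m) ω -
          Real.log (tiltMass n t m E ω.1) - n / 2 * Real.log (2 * Real.pi * t))
        ((i1.sub i2).sub ic) i4,
      integral_sub (f := fun ω : α × τ × (Fin n → ℝ) =>
        {ω | (ω.1, Y ω) ∈ E}.indicator (fun _ => Real.log m) ω -
          Real.log (tiltMass n t m E ω.1)) (i1.sub i2) ic, integral_sub i1 i2,
      integral_indicator_const _ hS, v2, integral_div]
    have : (∫ ω, ∑ i, Y ω i ^ 2 ∂ρ) / (2 * t) ≤ n / 2 := by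
      rw [div_le_div_iff₀ (by positivity) two_pos]
      linarith
    simp only [integral_const, probReal_univ, smul_eq_mul, one_mul]
    linarith
  obtain ⟨j₁, k₁⟩ := key hs₁ hE₁ h₁ hY₁m hi₁ hp₁
  obtain ⟨j₂, k₂⟩ := key hs₂ hE₂ h₂ hY₂m hi₂ hp₂
  have gauss : ∀ {w : ℝ}, 0 < w → ∀ {V : α × τ × (Fin n → ℝ) → Fin n → ℝ},
      MeasurePreserving V ρ (gaussianVec n w) →
      Integrable (fun ω => n / 2 * Real.log (2 * Real.pi * w) + (∑ i, V ω i ^ 2) / (2 * w)) ρ ∧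
      ∫ ω, (n / 2 * Real.log (2 * Real.pi * w) + (∑ i, V ω i ^ 2) / (2 * w)) ∂ρ =
        n / 2 * Real.log (2 * Real.pi * w) + n / 2 := by
    intro w hw V hV
    have i : Integrable (fun ω => ∑ i, V ω i ^ 2) ρ :=
      hV.integrable_comp_of_integrable (integrable_sum_sq_gaussianVec n w)
    have e : ∫ ω, ∑ i, V ω i ^ 2 ∂ρ = n * w := by
      rw [← integral_sum_sq_gaussianVec n hw.le, ← hV.map_eq,
        integral_map hV.measurable.aemeasurable
          (Finset.measurable_sum _ fun i _ => by fun_prop).aestronglyMeasurable]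
    refine ⟨(integrable_const _).add (i.div_const _), ?_⟩
    rw [integral_add (integrable_const _) (i.div_const _), integral_div, e]
    simp only [integral_const, probReal_univ, smul_eq_mul, one_mul]
    field_simp
  obtain ⟨ju, ku⟩ := gauss hu hmU
  obtain ⟨jv, kv⟩ := gauss hv hmN
  have hratio := lintegral_likelihoodRatio_le_one hv hu hU hB
    (r₁ := fun p => ENNReal.ofReal (Real.exp (tiltLog n s₁ m E₁ p)))
    (r₂ := fun p => ENNReal.ofReal (Real.exp (tiltLog n s₂ m E₂ p)))
    (Real.measurable_exp.comp (measurable_tiltLog hE₁)).ennreal_ofReal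
    (Real.measurable_exp.comp (measurable_tiltLog hE₂)).ennreal_ofReal (μ := μ)
    (lintegral_exp_tiltLog hs₁ hm hE₁) (lintegral_exp_tiltLog hs₂ hm hE₂)
  have hinv : ∀ w x, (ENNReal.ofReal (gaussianVecPDF n w x))⁻¹ = ENNReal.ofReal
      (Real.exp (n / 2 * Real.log (2 * Real.pi * w) + (∑ i, x i ^ 2) / (2 * w))) := by
    intro w x
    rw [← ENNReal.ofReal_inv_of_pos (gaussianVecPDF_pos _ _ _), gaussianVecPDF, ← Real.exp_neg]
    congr 2
    ring
  simp_rw [hinv, ← hY₂, ← hY₁, ← ENNReal.ofReal_mul (Real.exp_pos _).le, ← Real.exp_add,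
    ← ENNReal.ofReal_mul (Real.exp_pos _).le, ← Real.exp_add,
    ← ENNReal.ofReal_mul (Real.exp_pos _).le, ← Real.exp_add] at hratio
  have hL := integral_nonpos_of_lintegral_exp_le_one (((j₁.add j₂).add ju).add jv) hratio
  rw [integral_add' ((j₁.add j₂).add ju) jv, integral_add' (j₁.add j₂) ju,
    integral_add' j₁ j₂, ku, kv] at hL
  -- Two densities stand on each side of the ratio, so the `2 π` terms and the `n / 2` terms cancel.
  have l : ∀ {w : ℝ}, 0 < w →
      Real.log (2 * Real.pi * w) = Real.log (2 * Real.pi) + Real.log w := fun hw =>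
    Real.log_mul (by positivity) hw.ne'
  rw [l hs₁] at k₁
  rw [l hs₂] at k₂
  rw [l hu, l hv] at hL
  linarith

end Converse

/-! ### Second moments of sums. -/

section Power

variable {n : ℕ} {β : Type*} [MeasurableSpace β] {μ : Measure β}

lemma memLp_eval_of_integrable_sum_sq {X : β → Fin n → ℝ} (hX : Measurable X)
    (hXi : Integrable (fun b => ∑ i, X b i ^ 2) μ) (i : Fin n) :
    MemLp (fun b => X b i) 2 μ := by
  have hm : Measurable fun b => X b i := by fun_prop
  rw [memLp_two_iff_integrable_sq hm.aestronglyMeasurable]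
  refine hXi.mono' (by fun_prop) (ae_of_all _ fun b => ?_)
  rw [Real.norm_of_nonneg (sq_nonneg _)]
  exact Finset.single_le_sum (f := fun i => X b i ^ 2) (fun j _ => sq_nonneg _)
    (Finset.mem_univ i)

lemma integral_sum_add_sq {X S : β → Fin n → ℝ} (hX : Measurable X) (hS : Measurable S)
    (hXi : Integrable (fun b => ∑ i, X b i ^ 2) μ) (hSi : Integrable (fun b => ∑ i, S b i ^ 2) μ) :
    Integrable (fun b => ∑ i, X b i * S b i) μ ∧
    Integrable (fun b => ∑ i, (X b i + S b i) ^ 2) μ ∧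
    ∫ b, ∑ i, (X b i + S b i) ^ 2 ∂μ = ∫ b, ∑ i, X b i ^ 2 ∂μ + 2 * ∫ b, ∑ i, X b i * S b i ∂μ +
      ∫ b, ∑ i, S b i ^ 2 ∂μ := by
  have hc : Integrable (fun b => ∑ i, X b i * S b i) μ :=
    integrable_finsetSum _ fun i _ =>
      (memLp_eval_of_integrable_sum_sq hX hXi i).integrable_mul
        (memLp_eval_of_integrable_sum_sq hS hSi i)
  have e : ∀ b, ∑ i, (X b i + S b i) ^ 2 =
      ∑ i, X b i ^ 2 + 2 * ∑ i, X b i * S b i + ∑ i, S b i ^ 2 := by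
    intro b
    rw [Finset.mul_sum, ← Finset.sum_add_distrib, ← Finset.sum_add_distrib]
    exact Finset.sum_congr rfl fun i _ => by ring
  have h2 : Integrable (fun b => ∑ i, X b i ^ 2 + 2 * ∑ i, X b i * S b i) μ :=
    hXi.add (hc.const_mul 2)
  simp_rw [e]
  refine ⟨hc, h2.add hSi, ?_⟩
  rw [integral_add h2 hSi, integral_add hXi (hc.const_mul 2), integral_const_mul]

lemma integral_sum_add_sq_le {X S : β → Fin n → ℝ} (hX : Measurable X) (hS : Measurable S)
    (hXi : Integrable (fun b => ∑ i, X b i ^ 2) μ) (hSi : Integrable (fun b => ∑ i, S b i ^ 2) μ)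
    {p q : ℝ} (hp : ∫ b, ∑ i, X b i ^ 2 ∂μ ≤ p) (hq : ∫ b, ∑ i, S b i ^ 2 ∂μ ≤ q) :
    ∫ b, ∑ i, (X b i + S b i) ^ 2 ∂μ ≤ p + q + 2 * √(p * q) := by
  obtain ⟨hc, -, he⟩ := integral_sum_add_sq hX hS hXi hSi
  have hq0 : 0 ≤ ∫ b, ∑ i, S b i ^ 2 ∂μ :=
    integral_nonneg fun b => Finset.sum_nonneg fun i _ => sq_nonneg _
  have hp0 : 0 ≤ ∫ b, ∑ i, X b i ^ 2 ∂μ :=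
    integral_nonneg fun b => Finset.sum_nonneg fun i _ => sq_nonneg _
  have hd : discrim (∫ b, ∑ i, X b i ^ 2 ∂μ) (2 * ∫ b, ∑ i, X b i * S b i ∂μ)
      (∫ b, ∑ i, S b i ^ 2 ∂μ) ≤ 0 := by
    -- Cauchy–Schwarz for the summed cross term: the second moment of `t X + S` is a nonnegative
    -- quadratic in `t`.
    refine discrim_le_zero fun t => ?_
    have h0 : 0 ≤ ∫ b, ∑ i, (t * X b i + S b i) ^ 2 ∂μ :=
      integral_nonneg fun b => Finset.sum_nonneg fun i _ => sq_nonneg _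
    have ht : Integrable (fun b => ∑ i, (t * X b i) ^ 2) μ := by
      simp_rw [mul_pow, ← Finset.mul_sum]
      exact hXi.const_mul _
    rw [(integral_sum_add_sq (X := fun b i => t * X b i) (by fun_prop) hS ht hSi).2.2] at h0
    simp_rw [mul_pow, mul_assoc, ← Finset.mul_sum, integral_const_mul] at h0
    linarith
  have hle : ∫ b, ∑ i, X b i * S b i ∂μ ≤ √(p * q) := by
    refine Real.le_sqrt_of_sq_le ?_
    rw [discrim] at hd
    have : (∫ b, ∑ i, X b i ^ 2 ∂μ) * (∫ b, ∑ i, S b i ^ 2 ∂μ) ≤ p * q :=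
      mul_le_mul hp hq hq0 (hp0.trans hp)
    nlinarith
  linarith

/-- The cross term vanishes, because the noise is centred and independent of `X`. -/
lemma integral_sum_add_noise_sq [IsProbabilityMeasure μ] {X : β → Fin n → ℝ} (hX : Measurable X)
    (hXi : Integrable (fun b => ∑ i, X b i ^ 2) μ) :
    Integrable (fun p : β × (Fin n → ℝ) => ∑ i, (X p.1 i + p.2 i) ^ 2) (μ.prod (gaussianVec n 1)) ∧
    ∫ p, ∑ i, (X p.1 i + p.2 i) ^ 2 ∂(μ.prod (gaussianVec n 1)) =
      ∫ b, ∑ i, X b i ^ 2 ∂μ + n := by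
  have h1 : Integrable (fun p : β × (Fin n → ℝ) => ∑ i, X p.1 i ^ 2)
      (μ.prod (gaussianVec n 1)) := measurePreserving_fst.integrable_comp_of_integrable hXi
  have h2 : Integrable (fun p : β × (Fin n → ℝ) => ∑ i, p.2 i ^ 2)
      (μ.prod (gaussianVec n 1)) :=
    measurePreserving_snd.integrable_comp_of_integrable (integrable_sum_sq_gaussianVec n 1)
  obtain ⟨-, hi, he⟩ := integral_sum_add_sq (X := fun p : β × (Fin n → ℝ) => X p.1)
    (S := fun p => p.2) (by fun_prop) (by fun_prop) h1 h2
  refine ⟨hi, he.trans ?_⟩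
  have hc : ∫ p : β × (Fin n → ℝ), ∑ i, X p.1 i * p.2 i ∂(μ.prod (gaussianVec n 1)) = 0 := by
    rw [integral_finsetSum]
    · refine Finset.sum_eq_zero fun i _ => ?_
      rw [integral_prod_mul (fun b => X b i) (fun z : Fin n → ℝ => z i),
        integral_eval_gaussianVec, mul_zero]
    · intro i _
      exact ((memLp_eval_of_integrable_sum_sq hX hXi i).integrable one_le_two).mul_prod
        ((memLp_eval_gaussianVec 1 i).integrable one_le_two)
  rw [hc, integral_fun_fst (fun b => ∑ i, X b i ^ 2),
    integral_fun_snd (fun z : Fin n → ℝ => ∑ i, z i ^ 2),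
    integral_sum_sq_gaussianVec n zero_le_one]
  simp

end Power

/-! ### Guessing a uniform message. -/

section Guessing

variable {M : ℕ}

instance [NeZero M] : IsProbabilityMeasure (uniformOn (Set.univ : Set (Fin M))) :=
  isProbabilityMeasure_uniformOn Set.finite_univ Set.univ_nonempty

lemma integral_uniformOn_fin (f : Fin M → ℝ) :
    ∫ w, f w ∂(uniformOn Set.univ) = 1 / M * ∑ w, f w := by
  rw [uniformOn, ProbabilityTheory.cond, Measure.restrict_univ, integral_smul_measure, integral_count]
  simp [Measure.count_apply]

/-- Under a law `κ` that does not depend on the message, the events `g = w` partition the space, so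
any guess is correct with probability `1 / M`. This supplies the `1 / m` hypotheses of
`log_mul_prob_le`. -/
lemma integral_guess_uniformOn {β : Type*} [MeasurableSpace β] (κ : Measure β)
    [IsProbabilityMeasure κ] {g : β → Fin M} (hg : Measurable g) :
    ∫ w, κ.real {y | g y = w} ∂(uniformOn Set.univ) = 1 / M := by
  rw [integral_uniformOn_fin]
  have : ∑ w, κ.real {y | g y = w} = 1 := by
    have := sum_measureReal_preimage_singleton (μ := κ) (f := g) Finset.univ
      (fun w _ => hg (measurableSet_singleton w))
    simpa [Set.preimage] using this
  rw [this, mul_one]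

end Guessing

/-! ### Single-receiver law and coupling of the noises. -/

/-- Joint law of the message, the interferences and the noise of a single receiver. -/
def receiverLaw (n M : ℕ) (Q : ℝ) : Measure (Fin M × (Fin 2 → Fin n → ℝ) × (Fin n → ℝ)) :=
  (uniformOn (Set.univ : Set (Fin M))).prod ((whiteGaussian n Q).prod (gaussianVec n 1))

variable {n M : ℕ} {P Q : ℝ}

lemma measurePreserving_law_receiverLaw [NeZero M] (k : Fin 2) :
    MeasurePreserving (fun ω : Sample n M => (ω.1, ω.2.1, ω.2.2 k)) (law n M Q)
      (receiverLaw n M Q) :=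
  (MeasurePreserving.id _).prod ((MeasurePreserving.id _).prod
    (measurePreserving_eval (fun _ : Fin 2 => gaussianVec n 1) k))

lemma measurePreserving_law_fst [NeZero M] :
    MeasurePreserving (fun ω : Sample n M => (ω.1, ω.2.1)) (law n M Q)
      ((uniformOn (Set.univ : Set (Fin M))).prod (whiteGaussian n Q)) :=
  (MeasurePreserving.id _).prod measurePreserving_fst

lemma measurePreserving_receiverLaw_assoc [NeZero M] :
    MeasurePreserving (fun ω : Fin M × (Fin 2 → Fin n → ℝ) × (Fin n → ℝ) => ((ω.1, ω.2.1), ω.2.2))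
      (receiverLaw n M Q)
      (((uniformOn (Set.univ : Set (Fin M))).prod (whiteGaussian n Q)).prod (gaussianVec n 1)) :=
  (measurePreserving_prodAssoc _ _ _).symm

/-- The noise of one receiver as the combination of a common and a differential part. -/
lemma measurePreserving_splitNoise [NeZero M] {r b : ℝ} (h₀ : 0 ≤ r) (h₁ : r ≤ 1) (hb : b ^ 2 = 1) :
    MeasurePreserving
      (fun ω : Fin M × ((Fin 2 → Fin n → ℝ) × (Fin n → ℝ)) × (Fin n → ℝ) =>
        (ω.1, ω.2.1.1, fun i => b * ω.2.1.2 i + 1 * ω.2.2 i))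
      ((uniformOn (Set.univ : Set (Fin M))).prod
        (((whiteGaussian n Q).prod (gaussianVec n ((1 - r) / 2))).prod
          (gaussianVec n ((1 + r) / 2)))) (receiverLaw n M Q) :=
  (MeasurePreserving.id _).prod (((MeasurePreserving.id _).prod
    (measurePreserving_linearComb (by linarith) (by linarith) (by rw [hb]; ring))).comp
      (measurePreserving_prodAssoc _ _ _))

/-- The same noise splitting, regrouped so that the interference `ω.1.2` of receiver `1` joins the
message as side information. -/
lemma measurePreserving_splitNoise_side [NeZero M] {r b : ℝ} (h₀ : 0 ≤ r) (h₁ : r ≤ 1)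
    (hb : b ^ 2 = 1) :
    MeasurePreserving
      (fun ω : (Fin M × (Fin n → ℝ)) × ((Fin n → ℝ) × (Fin n → ℝ)) × (Fin n → ℝ) =>
        (ω.1.1, ![ω.2.1.1, ω.1.2], fun i => b * ω.2.1.2 i + 1 * ω.2.2 i))
      (((uniformOn (Set.univ : Set (Fin M))).prod (gaussianVec n Q)).prod
        (((gaussianVec n Q).prod (gaussianVec n ((1 - r) / 2))).prod
          (gaussianVec n ((1 + r) / 2)))) (receiverLaw n M Q) := by
  have hS : MeasurePreserving (fun p : (Fin n → ℝ) × (Fin n → ℝ) => ![p.1, p.2])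
      ((gaussianVec n Q).prod (gaussianVec n Q)) (whiteGaussian n Q) :=
    (measurePreserving_finTwoArrow (gaussianVec n Q)).symm
  have hZ := measurePreserving_linearComb (n := n) (v₁ := (1 - r) / 2) (v₂ := (1 + r) / 2) (v := 1)
    (a := b) (b := 1) (by linarith) (by linarith) (by rw [hb]; ring)
  exact ((MeasurePreserving.id _).prod (((hS.comp Measure.measurePreserving_swap).prod hZ).comp
    (((measurePreserving_prodAssoc _ _ _).symm).comp
      ((MeasurePreserving.id _).prod (measurePreserving_prodAssoc _ _ _))))).comp
    (measurePreserving_prodAssoc _ _ _)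

/-! ### Finite block length bounds for codes. -/

namespace Code

variable (c : Code n M)

lemma measurable_encode_uncurry :
    Measurable fun p : Fin M × (Fin 2 → Fin n → ℝ) => c.encode p.1 p.2 :=
  measurable_from_prod_countable_right c.measurable_encode

/-- The sequence received at receiver `k`, as a function of the noise of that receiver only. -/
def received (k : Fin 2) (ω : Fin M × (Fin 2 → Fin n → ℝ) × (Fin n → ℝ)) : Fin n → ℝ :=
  fun i => c.encode ω.1 ω.2.1 i + ω.2.1 k i + ω.2.2 i

lemma measurable_received (k : Fin 2) : Measurable (c.received k) := by
  have := c.measurable_encode_uncurry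
  unfold received
  refine measurable_pi_lambda _ fun i => ?_
  have h1 : Measurable fun ω : Fin M × (Fin 2 → Fin n → ℝ) × (Fin n → ℝ) =>
      c.encode ω.1 ω.2.1 i :=
    (measurable_pi_apply i).comp (this.comp (measurable_fst.prodMk measurable_snd.fst))
  fun_prop

lemma measurableSet_decoded (k : Fin 2) : MeasurableSet
    {ω : Fin M × (Fin 2 → Fin n → ℝ) × (Fin n → ℝ) | c.decode k (c.received k ω) = ω.1} :=
  measurableSet_eq_fun ((c.measurable_decode k).comp (c.measurable_received k)) measurable_fst

/-- Failure of receiver `k` is contained in the joint error event and involves only the noise of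
that receiver; this is what permits recoupling the noises. -/
lemma one_sub_errorProb_le [NeZero M] (k : Fin 2) :
    1 - (c.errorProb Q).toReal ≤
      (receiverLaw n M Q).real {ω | c.decode k (c.received k ω) = ω.1} := by
  have hm := measurePreserving_law_receiverLaw (n := n) (M := M) (Q := Q) k
  have : IsProbabilityMeasure (receiverLaw n M Q) := by unfold receiverLaw; infer_instance
  have : IsProbabilityMeasure (law n M Q) := by unfold law; infer_instance
  have hD := c.measurableSet_decoded k
  rw [← compl_compl {ω | c.decode k (c.received k ω) = ω.1}, probReal_compl_eq_one_sub hD.compl]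
  gcongr
  rw [measureReal_def, ← hm.measure_preimage hD.compl.nullMeasurableSet]
  exact ENNReal.toReal_mono (measure_ne_top _ _) (measure_mono fun ω hω => ⟨k, hω⟩)

lemma integrable_encode_sq [NeZero M] (h : c.SatisfiesPower P Q) :
    Integrable (fun p : Fin M × (Fin 2 → Fin n → ℝ) => ∑ i, c.encode p.1 p.2 i ^ 2)
      ((uniformOn (Set.univ : Set (Fin M))).prod (whiteGaussian n Q)) := by
  have hm := measurePreserving_law_fst (n := n) (M := M) (Q := Q)
  have := c.measurable_encode_uncurry
  exact (hm.integrable_comp (Finset.measurable_sum _ fun i _ =>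
    by fun_prop).aestronglyMeasurable).1 h.1

lemma integral_encode_sq_le [NeZero M] (hn : 0 < n) (h : c.SatisfiesPower P Q) :
    ∫ p, ∑ i, c.encode p.1 p.2 i ^ 2
      ∂((uniformOn (Set.univ : Set (Fin M))).prod (whiteGaussian n Q)) ≤ n * P := by
  have hm := measurePreserving_law_fst (n := n) (M := M) (Q := Q)
  have := c.measurable_encode_uncurry
  rw [← hm.map_eq, integral_map hm.measurable.aemeasurable (Finset.measurable_sum _ fun i _ =>
    by fun_prop).aestronglyMeasurable]
  have h2 := h.2
  have hn' : (0 : ℝ) < n := by exact_mod_cast hn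
  rwa [one_div, inv_mul_le_iff₀ hn'] at h2

lemma integral_interference_sq [NeZero M] (hQ : 0 ≤ Q) (k : Fin 2) :
    Integrable (fun p : Fin M × (Fin 2 → Fin n → ℝ) => ∑ i, p.2 k i ^ 2)
      ((uniformOn (Set.univ : Set (Fin M))).prod (whiteGaussian n Q)) ∧
    ∫ p : Fin M × (Fin 2 → Fin n → ℝ), ∑ i, p.2 k i ^ 2
      ∂((uniformOn (Set.univ : Set (Fin M))).prod (whiteGaussian n Q)) = n * Q := by
  have hm : MeasurePreserving (fun p : Fin M × (Fin 2 → Fin n → ℝ) => p.2 k)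
      ((uniformOn (Set.univ : Set (Fin M))).prod (whiteGaussian n Q)) (gaussianVec n Q) :=
    (measurePreserving_eval (fun _ : Fin 2 => gaussianVec n Q) k).comp measurePreserving_snd
  refine ⟨hm.integrable_comp_of_integrable (integrable_sum_sq_gaussianVec n Q), ?_⟩
  rw [← integral_sum_sq_gaussianVec n hQ, ← hm.map_eq, integral_map hm.measurable.aemeasurable]
  exact (Finset.measurable_sum _ fun i _ => by fun_prop).aestronglyMeasurable

lemma received_sq [NeZero M] (hn : 0 < n) (hQ : 0 ≤ Q)
    (h : c.SatisfiesPower P Q) (k : Fin 2) :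
    Integrable (fun ω => ∑ i, c.received k ω i ^ 2) (receiverLaw n M Q) ∧
    ∫ ω, ∑ i, c.received k ω i ^ 2 ∂(receiverLaw n M Q) ≤
      n * (P + Q + 1 + 2 * √(P * Q)) := by
  have hE := c.measurable_encode_uncurry
  have hm := measurePreserving_receiverLaw_assoc (n := n) (M := M) (Q := Q)
  have hSm : Measurable fun p : Fin M × (Fin 2 → Fin n → ℝ) => p.2 k := by fun_prop
  obtain ⟨hSi, hSq⟩ := integral_interference_sq (n := n) (M := M) hQ k
  have hXi := c.integrable_encode_sq h
  have hle := integral_sum_add_sq_le hE hSm hXi hSi (c.integral_encode_sq_le hn h) hSq.le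
  obtain ⟨hi, he⟩ := integral_sum_add_noise_sq
    (X := fun (p : Fin M × (Fin 2 → Fin n → ℝ)) i => c.encode p.1 p.2 i + p.2 k i)
    (by fun_prop) (integral_sum_add_sq hE hSm hXi hSi).2.1
  refine ⟨hm.integrable_comp_of_integrable hi, ?_⟩
  rw [← hm.map_eq, integral_map hm.measurable.aemeasurable (hm.map_eq.symm ▸ hi.1)] at he
  refine he.le.trans ?_
  have : √(n * P * (n * Q)) = n * √(P * Q) := by
    rw [show (n : ℝ) * P * (n * Q) = n ^ 2 * (P * Q) by ring,
      Real.sqrt_mul (by positivity), Real.sqrt_sq (by positivity)]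
  rw [this] at hle
  linarith

lemma received_sub_interference_sq [NeZero M] (hn : 0 < n) (h : c.SatisfiesPower P Q) (k : Fin 2) :
    Integrable (fun ω => ∑ i, (c.received k ω i - ω.2.1 k i) ^ 2) (receiverLaw n M Q) ∧
    ∫ ω, ∑ i, (c.received k ω i - ω.2.1 k i) ^ 2 ∂(receiverLaw n M Q) ≤ n * (1 + P) := by
  have hE := c.measurable_encode_uncurry
  have hm := measurePreserving_receiverLaw_assoc (n := n) (M := M) (Q := Q)
  obtain ⟨hi, he⟩ := integral_sum_add_noise_sq hE (c.integrable_encode_sq h)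
  have e : ∀ ω i, c.received k ω i - ω.2.1 k i = c.encode ω.1 ω.2.1 i + ω.2.2 i := fun ω i => by
    unfold received; ring
  simp_rw [e]
  refine ⟨hm.integrable_comp_of_integrable hi, ?_⟩
  rw [← hm.map_eq, integral_map hm.measurable.aemeasurable (hm.map_eq.symm ▸ hi.1)] at he
  refine he.le.trans ?_
  have := c.integral_encode_sq_le hn h
  linarith

/-- Converse for the two receivers with noise correlation `r`. -/
lemma log_card_le [NeZero M] (hn : 0 < n) (hP : 0 ≤ P) (hQ : 0 ≤ Q) (h : c.SatisfiesPower P Q)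
    {r : ℝ} (h₀ : 0 ≤ r) (h₁ : r ≤ 1) (hr : 0 < Q + 1 - r) :
    Real.log M * (2 - 2 * (c.errorProb Q).toReal) ≤
      2 + n / 2 * (Real.log (P + Q + 1 + 2 * √(P * Q)) + Real.log (P + Q + 1 + 2 * √(P * Q)) -
        Real.log ((1 + r) / 2) - Real.log (2 * (Q + 1 - r))) := by
  set A := P + Q + 1 + 2 * √(P * Q) with hA
  have hA0 : 0 < A := by positivity
  have hM : (1 : ℝ) ≤ M := by exact_mod_cast NeZero.one_le
  have hE := c.measurable_encode_uncurry
  -- The sign `b = 1` serves receiver `0` and `b = -1` receiver `1`; the outputs then share `ω.2.2`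
  -- and differ by the interference difference plus `2 * ω.2.1.2`.
  set ψ : ℝ → Fin M × ((Fin 2 → Fin n → ℝ) × (Fin n → ℝ)) × (Fin n → ℝ) →
      Fin M × (Fin 2 → Fin n → ℝ) × (Fin n → ℝ) :=
    fun b ω => (ω.1, ω.2.1.1, fun i => b * ω.2.1.2 i + 1 * ω.2.2 i) with hψ
  have hψ₁ := measurePreserving_splitNoise (n := n) (M := M) (Q := Q) h₀ h₁
    (show (1 : ℝ) ^ 2 = 1 by norm_num)
  have hψ₂ := measurePreserving_splitNoise (n := n) (M := M) (Q := Q) h₀ h₁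
    (show (-1 : ℝ) ^ 2 = 1 by norm_num)
  have hD : MeasurePreserving (fun (s : Fin 2 → Fin n → ℝ) i => 1 * s 0 i + (-1) * s 1 i)
      (whiteGaussian n Q) (gaussianVec n (2 * Q)) :=
    (measurePreserving_linearComb hQ hQ (by ring)).comp
      (measurePreserving_finTwoArrow (gaussianVec n Q))
  have hU : MeasurePreserving
      (fun (p : (Fin 2 → Fin n → ℝ) × (Fin n → ℝ)) i =>
        1 * (1 * p.1 0 i + (-1) * p.1 1 i) + 2 * p.2 i)
      ((whiteGaussian n Q).prod (gaussianVec n ((1 - r) / 2)))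
      (gaussianVec n (2 * (Q + 1 - r))) :=
    (measurePreserving_linearComb (by positivity) (by linarith) (by ring)).comp
      (hD.prod (MeasurePreserving.id _))
  have hB : Measurable fun (q : Fin M × (Fin 2 → Fin n → ℝ) × (Fin n → ℝ)) (i : Fin n) =>
      c.encode q.1 q.2.1 i + q.2.1 1 i - q.2.2 i := by
    refine measurable_pi_lambda _ fun i => ?_
    have h1 : Measurable fun q : Fin M × (Fin 2 → Fin n → ℝ) × (Fin n → ℝ) =>
        c.encode q.1 q.2.1 i :=
      (measurable_pi_apply i).comp (hE.comp (measurable_fst.prodMk measurable_snd.fst))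
    fun_prop
  have hEm : ∀ k, MeasurableSet {p : Fin M × (Fin n → ℝ) | c.decode k p.2 = p.1} := fun k =>
    measurableSet_eq_fun ((c.measurable_decode k).comp measurable_snd) measurable_fst
  obtain ⟨i₁, p₁⟩ := c.received_sq hn hQ h 0
  obtain ⟨i₂, p₂⟩ := c.received_sq hn hQ h 1
  rw [← hψ₁.map_eq, integral_map hψ₁.measurable.aemeasurable (hψ₁.map_eq.symm ▸ i₁.1)] at p₁
  rw [← hψ₂.map_eq, integral_map hψ₂.measurable.aemeasurable (hψ₂.map_eq.symm ▸ i₂.1)] at p₂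
  have key := log_mul_prob_le (v := (1 + r) / 2) (by linarith) (by linarith) hU hB hA0 hA0 hM
    (hEm 0) (hEm 1) (μ := uniformOn (Set.univ : Set (Fin M)))
    (integral_guess_uniformOn _ (c.measurable_decode 0)).le
    (integral_guess_uniformOn _ (c.measurable_decode 1)).le
    (Y₁ := fun ω => c.received 0 (ψ 1 ω)) (Y₂ := fun ω => c.received 1 (ψ (-1) ω))
    (fun ω => by funext i; simp only [received, hψ, Pi.add_apply]; ring)
    (fun ω => by funext i; simp only [received, hψ, Pi.add_apply]; ring)
    (hψ₁.integrable_comp_of_integrable i₁) (hψ₂.integrable_comp_of_integrable i₂) p₁ p₂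
  refine le_trans (mul_le_mul_of_nonneg_left ?_ (Real.log_nonneg hM)) key
  have e₁ := c.one_sub_errorProb_le (Q := Q) 0
  have e₂ := c.one_sub_errorProb_le (Q := Q) 1
  rw [← hψ₁.measureReal_preimage (c.measurableSet_decoded 0).nullMeasurableSet] at e₁
  rw [← hψ₂.measureReal_preimage (c.measurableSet_decoded 1).nullMeasurableSet] at e₂
  calc 2 - 2 * (c.errorProb Q).toReal
      = (1 - (c.errorProb Q).toReal) + (1 - (c.errorProb Q).toReal) := by ring
    _ ≤ _ := add_le_add e₁ e₂

/-- Converse with noise correlation `r` when receiver `1` is also given its interference. -/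
lemma log_card_le_side [NeZero M] (hn : 0 < n) (hP : 0 ≤ P) (hQ : 0 ≤ Q)
    (h : c.SatisfiesPower P Q) {r : ℝ} (h₀ : 0 ≤ r) (h₁ : r ≤ 1) (hr : 0 < Q + 2 * (1 - r)) :
    Real.log M * (2 - 2 * (c.errorProb Q).toReal) ≤
      2 + n / 2 * (Real.log (P + Q + 1 + 2 * √(P * Q)) + Real.log (1 + P) -
        Real.log ((1 + r) / 2) - Real.log (Q + 2 * (1 - r))) := by
  set A := P + Q + 1 + 2 * √(P * Q) with hA
  have hA0 : 0 < A := by positivity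
  have hM : (1 : ℝ) ≤ M := by exact_mod_cast NeZero.one_le
  have hE := c.measurable_encode_uncurry
  set ψ : ℝ → (Fin M × (Fin n → ℝ)) × ((Fin n → ℝ) × (Fin n → ℝ)) × (Fin n → ℝ) →
      Fin M × (Fin 2 → Fin n → ℝ) × (Fin n → ℝ) :=
    fun b ω => (ω.1.1, ![ω.2.1.1, ω.1.2], fun i => b * ω.2.1.2 i + 1 * ω.2.2 i) with hψ
  have hψ₁ := measurePreserving_splitNoise_side (n := n) (M := M) (Q := Q) h₀ h₁
    (show (1 : ℝ) ^ 2 = 1 by norm_num)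
  have hψ₂ := measurePreserving_splitNoise_side (n := n) (M := M) (Q := Q) h₀ h₁
    (show (-1 : ℝ) ^ 2 = 1 by norm_num)
  have hU : MeasurePreserving
      (fun (p : (Fin n → ℝ) × (Fin n → ℝ)) i => 1 * p.1 i + 2 * p.2 i)
      ((gaussianVec n Q).prod (gaussianVec n ((1 - r) / 2)))
      (gaussianVec n (Q + 2 * (1 - r))) :=
    measurePreserving_linearComb hQ (by linarith) (by ring)
  have hB : Measurable fun (q : (Fin M × (Fin n → ℝ)) × (Fin n → ℝ) × (Fin n → ℝ)) (i : Fin n) =>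
      c.encode q.1.1 ![q.2.1, q.1.2] i - q.2.2 i := by
    refine measurable_pi_lambda _ fun i => ?_
    have h0 : Measurable fun q : (Fin M × (Fin n → ℝ)) × (Fin n → ℝ) × (Fin n → ℝ) =>
        (![q.2.1, q.1.2] : Fin 2 → Fin n → ℝ) :=
      measurable_pi_lambda _ (Fin.forall_fin_two.2 ⟨measurable_snd.fst, measurable_fst.snd⟩)
    have h1 : Measurable fun q : (Fin M × (Fin n → ℝ)) × (Fin n → ℝ) × (Fin n → ℝ) =>
        c.encode q.1.1 ![q.2.1, q.1.2] i :=
      (measurable_pi_apply i).comp (hE.comp (measurable_fst.fst.prodMk h0))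
    fun_prop
  have hE₁ : MeasurableSet
      {p : (Fin M × (Fin n → ℝ)) × (Fin n → ℝ) | c.decode 0 p.2 = p.1.1} :=
    measurableSet_eq_fun ((c.measurable_decode 0).comp measurable_snd) measurable_fst.fst
  -- The second output is taken with its interference removed, so the known interference is added
  -- back before decoding.
  have hE₂ : MeasurableSet
      {p : (Fin M × (Fin n → ℝ)) × (Fin n → ℝ) | c.decode 1 (p.2 + p.1.2) = p.1.1} :=
    measurableSet_eq_fun ((c.measurable_decode 1).comp (by fun_prop)) measurable_fst.fst
  have guess : ∀ {s : ℝ} {E : Set ((Fin M × (Fin n → ℝ)) × (Fin n → ℝ))}, MeasurableSet E →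
      (∀ x, ∃ g : (Fin n → ℝ) → Fin M, Measurable g ∧ ∀ w y, ((w, x), y) ∈ E ↔ g y = w) →
      ∫ a, (gaussianVec n s).real {y | (a, y) ∈ E}
        ∂((uniformOn (Set.univ : Set (Fin M))).prod (gaussianVec n Q)) ≤ 1 / M := by
    intro s E hEm hg
    -- Fixing the side information first leaves a guess that depends on `y` alone, with the message
    -- still uniform.
    rw [integral_prod_symm _ (Integrable.of_bound (measurable_section_real hEm).aestronglyMeasurable
      1 (ae_of_all _ fun a => by
        rw [Real.norm_of_nonneg measureReal_nonneg]; exact measureReal_le_one))]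
    refine le_of_eq ((integral_congr_ae (ae_of_all _ fun x => ?_)).trans
      (integral_const (1 / (M : ℝ)) |>.trans (by simp)))
    obtain ⟨g, hgm, hgE⟩ := hg x
    simp only [hgE]
    exact integral_guess_uniformOn _ hgm
  obtain ⟨i₁, p₁⟩ := c.received_sq hn hQ h 0
  obtain ⟨i₂, p₂⟩ := c.received_sub_interference_sq hn h 1
  rw [← hψ₁.map_eq, integral_map hψ₁.measurable.aemeasurable (hψ₁.map_eq.symm ▸ i₁.1)] at p₁
  rw [← hψ₂.map_eq, integral_map hψ₂.measurable.aemeasurable (hψ₂.map_eq.symm ▸ i₂.1)] at p₂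
  have key := log_mul_prob_le (v := (1 + r) / 2) (by linarith) hr hU hB hA0 (by linarith) hM
    hE₁ hE₂ (μ := (uniformOn (Set.univ : Set (Fin M))).prod (gaussianVec n Q))
    (guess hE₁ fun x => ⟨c.decode 0, c.measurable_decode 0, fun w y => Iff.rfl⟩)
    (guess hE₂ fun x => ⟨fun y => c.decode 1 (y + x), (c.measurable_decode 1).comp (by fun_prop),
      fun w y => Iff.rfl⟩)
    (Y₁ := fun ω => c.received 0 (ψ 1 ω))
    (Y₂ := fun ω i => c.received 1 (ψ (-1) ω) i - (ψ (-1) ω).2.1 1 i)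
    (fun ω => by funext i; simp [received, hψ]; ring)
    (fun ω => by funext i; simp [received, hψ]; ring)
    (hψ₁.integrable_comp_of_integrable i₁) (hψ₂.integrable_comp_of_integrable i₂) p₁ p₂
  refine le_trans (mul_le_mul_of_nonneg_left ?_ (Real.log_nonneg hM)) key
  have e₁ := c.one_sub_errorProb_le (Q := Q) 0
  have e₂ := c.one_sub_errorProb_le (Q := Q) 1
  rw [← hψ₁.measureReal_preimage (c.measurableSet_decoded 0).nullMeasurableSet] at e₁
  rw [← hψ₂.measureReal_preimage (c.measurableSet_decoded 1).nullMeasurableSet] at e₂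
  calc 2 - 2 * (c.errorProb Q).toReal
      = (1 - (c.errorProb Q).toReal) + (1 - (c.errorProb Q).toReal) := by ring
    _ ≤ _ := add_le_add e₁ (e₂.trans_eq (by
      congr 1
      ext ω
      have : (fun i => c.received 1 (ψ (-1) ω) i - (ψ (-1) ω).2.1 1 i) + ω.1.2 =
          c.received 1 (ψ (-1) ω) := by
        funext i
        simp [hψ]
      change _ ↔ c.decode 1 ((fun i => c.received 1 (ψ (-1) ω) i - (ψ (-1) ω).2.1 1 i) + ω.1.2) = _
      rw [this]
      rfl))

end Code

/-! ### Passage to large block length. -/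

lemma le_of_log_card_le {P Q R K : ℝ} (hR : Achievable P Q R)
    (h : ∀ {n M : ℕ} [NeZero M] (c : Code n M), 0 < n → c.SatisfiesPower P Q →
      Real.log M * (2 - 2 * (c.errorProb Q).toReal) ≤ 2 + n / 2 * K) :
    R ≤ K / (4 * Real.log 2) := by
  obtain ⟨hR0, c, hc, hlim⟩ := hR
  have hl2 : 0 < Real.log 2 := Real.log_pos one_lt_two
  have hlim' : Tendsto (fun n => ((c n).errorProb Q).toReal) atTop (𝓝 0) := by
    simpa [Function.comp_def] using (ENNReal.tendsto_toReal ENNReal.zero_ne_top).comp hlim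
  have hinv : Tendsto (fun n : ℕ => ((n : ℝ))⁻¹) atTop (𝓝 0) :=
    tendsto_inv_atTop_nhds_zero_nat
  have hleft : Tendsto (fun n : ℕ => (R * Real.log 2 - Real.log 2 * (n : ℝ)⁻¹) *
      (2 - 2 * ((c n).errorProb Q).toReal)) atTop
      (𝓝 ((R * Real.log 2 - Real.log 2 * 0) * (2 - 2 * 0))) :=
    (tendsto_const_nhds.sub (hinv.const_mul _)).mul (tendsto_const_nhds.sub (hlim'.const_mul _))
  have hright : Tendsto (fun n : ℕ => 2 * (n : ℝ)⁻¹ + K / 2) atTop (𝓝 (2 * 0 + K / 2)) :=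
    (hinv.const_mul _).add tendsto_const_nhds
  have hlt : ∀ᶠ n in atTop, ((c n).errorProb Q).toReal < 1 :=
    hlim'.eventually (gt_mem_nhds one_pos)
  have hle := le_of_tendsto_of_tendsto hleft hright (by
    filter_upwards [hlt, eventually_gt_atTop 0] with n hn1 hn
    have hn0 : (0 : ℝ) < n := by exact_mod_cast hn
    have hone : (1 : ℝ) ≤ (2 : ℝ) ^ ((n : ℝ) * R) :=
      Real.one_le_rpow one_le_two (by positivity)
    have hfl : 1 ≤ ⌊(2 : ℝ) ^ ((n : ℝ) * R)⌋₊ := by rwa [Nat.one_le_floor_iff]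
    have : NeZero ⌊(2 : ℝ) ^ ((n : ℝ) * R)⌋₊ := ⟨by omega⟩
    -- For `x ≥ 1` the floor is at least `x / 2`, so rounding costs at most `log 2`, which vanishes
    -- after division by `n`.
    have hM : n * R * Real.log 2 - Real.log 2 ≤ Real.log ⌊(2 : ℝ) ^ ((n : ℝ) * R)⌋₊ := by
      rw [← Real.log_rpow two_pos, ← Real.log_div (by positivity) two_ne_zero]
      refine Real.log_le_log (by positivity) ?_
      have h1 := Nat.lt_floor_add_one ((2 : ℝ) ^ ((n : ℝ) * R))
      have h2 : (1 : ℝ) ≤ ⌊(2 : ℝ) ^ ((n : ℝ) * R)⌋₊ := by exact_mod_cast hfl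
      linarith
    have hmain := (mul_le_mul_of_nonneg_right hM
      (by linarith : 0 ≤ 2 - 2 * ((c n).errorProb Q).toReal)).trans (h (c n) hn (hc n))
    have e1 : (n : ℝ) * ((R * Real.log 2 - Real.log 2 * (n : ℝ)⁻¹) *
        (2 - 2 * ((c n).errorProb Q).toReal)) = (n * R * Real.log 2 - Real.log 2) *
        (2 - 2 * ((c n).errorProb Q).toReal) := by field_simp
    have e2 : (n : ℝ) * (2 * (n : ℝ)⁻¹ + K / 2) = 2 + n / 2 * K := by field_simp
    refine le_of_mul_le_mul_left ?_ hn0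
    rw [e1, e2]
    exact hmain)
  rw [le_div_iff₀ (by positivity)]
  linarith

/-! ### Choice of the noise correlation and the two bounds. -/

variable {P Q R : ℝ}

lemma le_boundI (hP : 0 ≤ P) (hQ : 0 ≤ Q) (hR : Achievable P Q R) : R ≤ boundI P Q := by
  set A := P + Q + 1 + 2 * √(P * Q) with hA
  have hA0 : 0 < A := by positivity
  have hP0 : 0 < 1 + P := by linarith
  have key : ∀ r, 0 ≤ r → r ≤ 1 → 0 < Q + 2 * (1 - r) →
      R ≤ 1 / 4 * Real.logb 2 (1 + P) + 1 / 4 * Real.logb 2 A -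
        1 / 4 * Real.logb 2 ((1 + r) / 2 * (Q + 2 * (1 - r))) := by
    intro r h₀ h₁ hr
    refine (le_of_log_card_le hR fun c hn hc => c.log_card_le_side hn hP hQ hc h₀ h₁ hr).trans_eq ?_
    rw [← hA, Real.logb_mul (by positivity) hr.ne']
    unfold Real.logb
    field_simp
    ring
  unfold boundI
  rw [← hA]
  split_ifs with h4
  -- On `[0, 1]` the product `(1 + r) / 2 * (Q + 2 * (1 - r))` is largest at `r = min (Q / 4) 1`.
  · have := key 1 zero_le_one le_rfl (by linarith)
    rw [Real.logb_div hA0.ne' (by linarith)]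
    rw [show (1 + 1 : ℝ) / 2 * (Q + 2 * (1 - 1)) = Q by ring] at this
    linarith
  · push Not at h4
    have := key (Q / 4) (by linarith) (by linarith) (by linarith)
    have hq : 0 < Q / 4 + 1 := by linarith
    rw [Real.logb_div hA0.ne' hq.ne', Real.logb_div hP0.ne' hq.ne']
    rw [show (1 + Q / 4) / 2 * (Q + 2 * (1 - Q / 4)) = (Q / 4 + 1) * (Q / 4 + 1) by ring,
      Real.logb_mul hq.ne' hq.ne'] at this
    linarith

/-- The bound on the sum rate without the correction term of `boundII` for large interference. -/
lemma le_boundII_uncorrected (hP : 0 ≤ P) (hQ : 0 ≤ Q) (hR : Achievable P Q R) :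
    R ≤ if Q ≤ 2 then 1 / 2 * Real.logb 2 ((1 + P + Q + 2 * √(P * Q)) / (1 + Q / 2))
      else 1 / 2 * Real.logb 2 ((1 + P + Q + 2 * √(P * Q)) / √(2 * Q)) := by
  rw [show 1 + P + Q + 2 * √(P * Q) = P + Q + 1 + 2 * √(P * Q) by ring]
  set A := P + Q + 1 + 2 * √(P * Q) with hA
  have hA0 : 0 < A := by positivity
  have key : ∀ r, 0 ≤ r → r ≤ 1 → 0 < Q + 1 - r →
      R ≤ 1 / 2 * Real.logb 2 A -
        1 / 4 * Real.logb 2 ((1 + r) / 2 * (2 * (Q + 1 - r))) := by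
    intro r h₀ h₁ hr
    refine (le_of_log_card_le hR fun c hn hc => c.log_card_le hn hP hQ hc h₀ h₁ hr).trans_eq ?_
    rw [← hA, Real.logb_mul (by positivity) (by positivity)]
    unfold Real.logb
    field_simp
    ring
  split_ifs with h2
  -- Here `(1 + r) * (Q + 1 - r)` is to be maximised on `[0, 1]`, which gives `r = min (Q / 2) 1`.
  · have := key (Q / 2) (by linarith) (by linarith) (by linarith)
    have hq : 0 < 1 + Q / 2 := by linarith
    rw [Real.logb_div hA0.ne' hq.ne']
    rw [show (1 + Q / 2) / 2 * (2 * (Q + 1 - Q / 2)) = (1 + Q / 2) * (1 + Q / 2) by ring,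
      Real.logb_mul hq.ne' hq.ne'] at this
    linarith
  · push Not at h2
    have := key 1 zero_le_one le_rfl (by linarith)
    rw [Real.logb_div hA0.ne' (by positivity), Real.sqrt_eq_rpow, Real.logb_rpow_eq_mul_logb_of_pos
      (by positivity)]
    rw [show (1 + 1 : ℝ) / 2 * (2 * (Q + 1 - 1)) = 2 * Q by ring] at this
    linarith

/-- For large interference the correction term of `boundII` is already accounted for by `boundI`. -/
lemma boundI_le_of_two_lt (hP : 0 ≤ P) (hQ : 2 < Q) :
    boundI P Q ≤ 1 / 2 * Real.logb 2 ((1 + P + Q + 2 * √(P * Q)) / √(2 * Q)) -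
      1 / 4 * Real.logb 2 (Q / (2 * P + 2)) := by
  have hQ0 : 0 < Q := by linarith
  rw [show 1 + P + Q + 2 * √(P * Q) = P + Q + 1 + 2 * √(P * Q) by ring,
    show 2 * P + 2 = 2 * (1 + P) by ring]
  set A := P + Q + 1 + 2 * √(P * Q) with hA
  have hs : 0 ≤ √(P * Q) := Real.sqrt_nonneg _
  have hP0 : 0 < 1 + P := by linarith
  have hA0 : 0 < A := by positivity
  -- After the logarithms are expanded, the right-hand side is `1/4 log (1 + P) + 1/2 log (A / Q)`,
  -- so `A ≥ Q` leaves room to spare.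
  have hQA : Real.logb 2 Q ≤ Real.logb 2 A :=
    Real.logb_le_logb_of_le one_lt_two hQ0 (by linarith)
  rw [Real.logb_div hA0.ne' (by positivity), Real.sqrt_eq_rpow,
    Real.logb_rpow_eq_mul_logb_of_pos (by positivity), Real.logb_div hQ0.ne' (by positivity),
    Real.logb_mul two_ne_zero hQ0.ne', Real.logb_mul two_ne_zero hP0.ne']
  unfold boundI
  rw [← hA]
  split_ifs with h4
  · rw [Real.logb_div hA0.ne' hQ0.ne']
    linarith
  · have hq : 0 < Q / 4 + 1 := by linarith
    rw [Real.logb_div hA0.ne' hq.ne', Real.logb_div hP0.ne' hq.ne']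
    -- This is AM–GM: `(Q / 4 + 1) ^ 2 ≥ Q`.
    have : Real.logb 2 Q ≤ 2 * Real.logb 2 (Q / 4 + 1) := by
      rw [two_mul, ← Real.logb_mul hq.ne' hq.ne']
      exact Real.logb_le_logb_of_le one_lt_two hQ0 (by nlinarith [sq_nonneg (Q / 4 - 1)])
    linarith

lemma le_boundII (hP : 0 ≤ P) (hQ : 0 ≤ Q) (hR : Achievable P Q R) : R ≤ boundII P Q := by
  have h := le_boundII_uncorrected hP hQ hR
  unfold boundII
  split_ifs at h ⊢ with h2
  · exact h
  · push Not at h2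
    rcases max_cases (1 / 4 * Real.logb 2 (Q / (2 * P + 2))) 0 with ⟨hm, -⟩ | ⟨hm, -⟩
    · rw [hm]
      exact (le_boundI hP hQ hR).trans (boundI_le_of_two_lt hP h2)
    · rwa [hm, sub_zero]

end GaussianMulticast

end

theorem theorem3 (P Q : ℝ) (hP : 0 ≤ P) (hQ : 0 ≤ Q) :
    GaussianMulticast.capacity P Q ≤
      ((min (GaussianMulticast.boundI P Q) (GaussianMulticast.boundII P Q) : ℝ) : EReal) :=
  iSup₂_le fun _ hR => EReal.coe_le_coe_iff.2
    (le_min (GaussianMulticast.le_boundI hP hQ hR) (GaussianMulticast.le_boundII hP hQ hR))
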